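/- Let $G$ be a compact topological group (not assumed Hausdorff) with identity $1$ and let $X$ be a topological space. Let $\eta\colon G*X\to X$, $(g,x)\mapsto g\cdot x$, be a partial action of $G$ on $X$, that is, a function defined on a subset $G*X\subseteq G\times X$ such that for all $g,h\in G$ and $x\in X$, writing $\exists\, g\cdot x$ for $(g,x)\in G*X$: - if $\exists\, g\cdot x$, then $\exists\, g^{-1}\cdot(g\cdot x)$ and $g^{-1}\cdot(g\cdot x)=x$; - if $\exists\, h\cdot x$ and $\exists\, g\cdot(h\cdot x)$, then $\exists\, (gh)\cdot x$ and $g\cdot(h\cdot x)=(gh)\cdot x$; - $\exists\, 1\cdot x$ and $1\cdot x=x$. Assume that $\eta$ is continuous, where $G*X$ carries the subspace topology of the product $G\times X$, and topological: for every $g\in G$ the set $X_g=\{x\in X : \exists\, g^{-1}\cdot x\}$ is open in $X$ and the map $X_{g^{-1}}\to X_g$, $x\mapsto g\cdot x$, is a homeomorphism. Assume moreover that $G*X$ is closed in $G\times X$. Let $X/\!\sim_G$ be the quotient space of $X$ by the equivalence relation $x\sim_G y\iff$ there is $g\in G$ such that $\exists\, g\cdot x$ and $g\cdot x=y$. Let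 $X_G$ be the enveloping space, i.e. the quotient space of $G\times X$ by the equivalence relation $(g,x)\,R\,(h,y)\iff \exists\,(h^{-1}g)\cdot x$ and $(h^{-1}g)\cdot x=y$. Let $\mathcal P$ be any one of the following properties of topological spaces: Hausdorff; regular (either in the sense that a closed set and a point outside it have disjoint neighbourhoods, or in the sense that in addition the space is Hausdorff); metrizable; second countable. Then: (i) if $X$ has $\mathcal P$, then $X/\!\sim_G$ has $\mathcal P$; (ii) if $G\times X$ has $\mathcal P$, then $X_G$ has $\mathcal P$. -/

import Mathlib

/-- A partial action of a group `G` on a set `X`: a function `(g, x) ↦ g · x` defined on a subset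
`dom` (written `G * X`) of `G × X` and subject to (PA1), (PA2), (PA3). -/
structure PartialAction (G : Type*) (X : Type*) [Group G] where
  /-- The domain `G * X`; `(g, x) ∈ dom` means that `g · x` exists. -/
  dom : Set (G × X)
  /-- The value `g · x`, for `(g, x)` in the domain. -/
  act : ∀ (g : G) (x : X), (g, x) ∈ dom → X
  /-- (PA1), existence. -/
  inv_mem : ∀ (g : G) (x : X) (h : (g, x) ∈ dom), (g⁻¹, act g x h) ∈ dom
  /-- (PA1), value. -/
  inv_act : ∀ (g : G) (x : X) (h : (g, x) ∈ dom), act g⁻¹ (act g x h) (inv_mem g x h) = x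
  /-- (PA2), existence. -/
  mul_mem : ∀ (g k : G) (x : X) (hk : (k, x) ∈ dom), (g, act k x hk) ∈ dom → (g * k, x) ∈ dom
  /-- (PA2), value. -/
  act_act : ∀ (g k : G) (x : X) (hk : (k, x) ∈ dom) (hg : (g, act k x hk) ∈ dom),
    act g (act k x hk) hg = act (g * k) x (mul_mem g k x hk hg)
  /-- (PA3), existence. -/
  one_mem : ∀ x : X, (1, x) ∈ dom
  /-- (PA3), value. -/
  one_act : ∀ x : X, act 1 x (one_mem x) = x

namespace PartialAction

variable {G : Type*} {X : Type*} [Group G] (η : PartialAction G X)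

theorem act_congr {g k : G} {x y : X} (hgk : g = k) (hxy : x = y) (h : (g, x) ∈ η.dom) :
    η.act g x h = η.act k y (hgk ▸ hxy ▸ h) := by
  subst hgk; subst hxy; rfl

/-- The set `X_g` of all `x` for which `g⁻¹ · x` exists. -/
def domAt (g : G) : Set X := {x | (g⁻¹, x) ∈ η.dom}

/-- The map `η_g : X_{g⁻¹} → X_g`, `x ↦ g · x`. -/
def mapAt (g : G) (x : η.domAt g⁻¹) : η.domAt g :=
  have h : (g, (x : X)) ∈ η.dom := by simpa [domAt] using x.2
  ⟨η.act g x h, η.inv_mem g x h⟩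

/-- The partial action is continuous (as a map `G * X → X`, where `G * X` has the subspace topology
of `G × X`) and topological (every `X_g` is open and every `η_g : X_{g⁻¹} → X_g` is a
homeomorphism). -/
structure IsContinuousTopological [TopologicalSpace G] [TopologicalSpace X] : Prop where
  continuous_act : Continuous fun p : η.dom => η.act p.1.1 p.1.2 p.2
  isOpen_domAt : ∀ g : G, IsOpen (η.domAt g)
  isHomeomorph_mapAt : ∀ g : G, IsHomeomorph (η.mapAt g)

/-- The orbit equivalence relation: `x ∼ y` iff `g · x` exists and equals `y` for some `g`. -/
def orbitSetoid : Setoid X where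
  r x y := ∃ (g : G) (h : (g, x) ∈ η.dom), η.act g x h = y
  iseqv :=
    { refl := fun x => ⟨1, η.one_mem x, η.one_act x⟩
      symm := by
        rintro x _ ⟨g, h, rfl⟩
        exact ⟨g⁻¹, η.inv_mem g x h, η.inv_act g x h⟩
      trans := by
        rintro x _ _ ⟨g, h, rfl⟩ ⟨k, hk, rfl⟩
        exact ⟨k * g, η.mul_mem k g x h hk, (η.act_act k g x h hk).symm⟩ }

/-- The orbit space `X/∼_G`, which carries the quotient topology of `X`. -/
abbrev OrbitSpace : Type _ := Quotient η.orbitSetoid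

/-- The relation `R` on `G × X`: `(g, x) R (k, y)` iff `(k⁻¹ g) · x` exists and equals `y`. -/
def envelopingSetoid : Setoid (G × X) where
  r p q := ∃ h : (q.1⁻¹ * p.1, p.2) ∈ η.dom, η.act (q.1⁻¹ * p.1) p.2 h = q.2
  iseqv :=
    { refl := by
        rintro ⟨g, x⟩
        have e : (1 : G) = g⁻¹ * g := by group
        exact ⟨e ▸ η.one_mem x, ((η.act_congr e rfl (η.one_mem x)).symm.trans (η.one_act x))⟩
      symm := by
        rintro ⟨g, x⟩ ⟨k, y⟩ ⟨h, hy⟩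
        dsimp only at h hy
        subst hy
        have e : (k⁻¹ * g)⁻¹ = g⁻¹ * k := by group
        exact ⟨e ▸ η.inv_mem _ x h,
          (η.act_congr e rfl (η.inv_mem _ x h)).symm.trans (η.inv_act _ x h)⟩
      trans := by
        rintro ⟨g, x⟩ ⟨k, y⟩ ⟨l, z⟩ ⟨h, hy⟩ ⟨h', hz⟩
        dsimp only at h hy h' hz
        subst hy hz
        have e : l⁻¹ * k * (k⁻¹ * g) = l⁻¹ * g := by group
        exact ⟨e ▸ η.mul_mem _ _ x h h',
          ((η.act_act _ _ x h h').trans (η.act_congr e rfl (η.mul_mem _ _ x h h'))).symm⟩ }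

/-- The enveloping space `X_G = (G × X)/R`, which carries the quotient topology of `G × X`. -/
abbrev EnvelopingSpace : Type _ := Quotient η.envelopingSetoid

end PartialAction

/-!
The orbits are the classes of the groupoid on `G * X` with source `(g, x) ↦ x` and target
`(g, x) ↦ g · x`, so the saturation of `s ⊆ X` is `source '' (target ⁻¹' s)` and the orbit of `x` is
`target '' (source ⁻¹' {x})`. The source map is open because every `X_g` is open, and proper because
`G` is compact and `G * X` is closed; hence the quotient map `X → X/∼_G` is open and proper as well.
Sending a point of `X/∼_G` to its fibre therefore embeds `X/∼_G` into the space of nonempty compact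
subsets of `X` with the Vietoris topology, which inherits each of the properties from `X`.

The space `X_G` is the orbit space of the partial action `k · (g, x) = (g k⁻¹, k · x)` on `G × X`.
-/

open Topology TopologicalSpace Set

section Fiber

variable {X Y : Type*} [TopologicalSpace X] [TopologicalSpace Y] {f : X → Y}

/-- The fibres of a proper surjection, as points of the hyperspace of nonempty compact sets. -/
def compactFiber (hsurj : Function.Surjective f) (hproper : IsProperMap f) (y : Y) :
    NonemptyCompacts X where
  carrier := f ⁻¹' {y}
  isCompact' := hproper.isCompact_preimage isCompact_singleton
  nonempty' := hsurj y

theorem compactFiber_injective (hsurj : Function.Surjective f) (hproper : IsProperMap f) :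
    Function.Injective (compactFiber hsurj hproper) := fun _ _ h =>
  singleton_injective (hsurj.preimage_injective (congrArg SetLike.coe h))

theorem continuous_compactFiber (hopen : IsOpenQuotientMap f) (hproper : IsProperMap f) :
    Continuous (compactFiber hopen.surjective hproper) := by
  let : TopologicalSpace (Set X) := .vietoris X
  rw [NonemptyCompacts.isEmbedding_coe.continuous_iff, vietoris.continuous_iff]
  exact ⟨fun U hU => show IsOpen (kernImage f U) from
      isClosedMap_iff_kernImage.1 hproper.isClosedMap hU,
    fun F hF => show IsClosed (kernImage f F) from
      isOpenMap_iff_kernImage.1 hopen.isOpenMap hF⟩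

theorem isEmbedding_compactFiber (hopen : IsOpenQuotientMap f) (hproper : IsProperMap f) :
    IsEmbedding (compactFiber hopen.surjective hproper) := by
  refine ⟨⟨le_antisymm (continuous_compactFiber hopen hproper).le_induced fun U hU => ?_⟩,
    compactFiber_injective hopen.surjective hproper⟩
  refine ⟨{K | (K : Set X) ⊆ f ⁻¹' U},
    NonemptyCompacts.isOpen_subsets_of_isOpen (hU.preimage hproper.continuous), ?_⟩
  ext y
  change f ⁻¹' {y} ⊆ f ⁻¹' U ↔ y ∈ U
  rw [hopen.surjective.preimage_subset_preimage_iff, singleton_subset_iff]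

instance [MetrizableSpace X] : MetrizableSpace (NonemptyCompacts X) := by
  let := metrizableSpaceMetric X
  infer_instance

end Fiber

namespace PartialAction

variable {G X : Type*} [Group G] (η : PartialAction G X)

/-- The source map `(g, x) ↦ x` of the groupoid on `G * X`. -/
def source (p : η.dom) : X := p.1.2

/-- The target map `(g, x) ↦ g · x` of the groupoid on `G * X`; it is the partial action itself, as
a function on its domain. -/
def target (p : η.dom) : X := η.act p.1.1 p.1.2 p.2

theorem mk_eq_mk_iff {x y : X} :
    (⟦x⟧ : η.OrbitSpace) = ⟦y⟧ ↔ ∃ p, η.source p = x ∧ η.target p = y := by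
  rw [Quotient.eq]
  constructor
  · rintro ⟨g, h, rfl⟩
    exact ⟨⟨(g, x), h⟩, rfl, rfl⟩
  · rintro ⟨⟨⟨g, x⟩, h⟩, rfl, rfl⟩
    exact ⟨g, h, rfl⟩

theorem mk_preimage_image_mk (s : Set X) :
    Quotient.mk η.orbitSetoid ⁻¹' (Quotient.mk η.orbitSetoid '' s) =
      η.source '' (η.target ⁻¹' s) := by
  ext x
  simp only [mem_preimage, mem_image, eq_comm (b := Quotient.mk _ x), mk_eq_mk_iff]
  grind

theorem mk_preimage_singleton_mk (x : X) :
    Quotient.mk η.orbitSetoid ⁻¹' {Quotient.mk η.orbitSetoid x} =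
      η.target '' (η.source ⁻¹' {x}) := by
  ext y
  simp only [mem_preimage, mem_singleton_iff, mem_image, eq_comm (a := Quotient.mk _ y),
    mk_eq_mk_iff]

/-- The partial action `k · (g, x) = (g k⁻¹, k · x)` on `G × X`, whose orbit space is the enveloping
space of `η`. -/
def prodAction : PartialAction G (G × X) where
  dom := {p | (p.1, p.2.2) ∈ η.dom}
  act k p h := (p.1 * k⁻¹, η.act k p.2 h)
  inv_mem k p h := η.inv_mem k p.2 h
  inv_act k p h := Prod.ext (by simp) (η.inv_act k p.2 h)
  mul_mem k l p hl hk := η.mul_mem k l p.2 hl hk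
  act_act k l p hl hk := Prod.ext (by simp [mul_assoc]) (η.act_act k l p.2 hl hk)
  one_mem p := η.one_mem p.2
  one_act p := Prod.ext (by simp) (η.one_act p.2)

theorem orbitSetoid_prodAction : η.prodAction.orbitSetoid = η.envelopingSetoid := by
  ext ⟨g, x⟩ ⟨k, y⟩
  constructor
  · rintro ⟨l, h, e⟩
    obtain ⟨rfl, rfl⟩ := Prod.mk.inj e
    have hl : l = (g * l⁻¹)⁻¹ * g := by group
    have h' : (l, x) ∈ η.dom := h
    exact ⟨hl ▸ h', (η.act_congr hl rfl h').symm⟩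
  · rintro ⟨h, e⟩
    exact ⟨k⁻¹ * g, h, Prod.ext (by simp [prodAction]) e⟩

variable [TopologicalSpace G] [TopologicalSpace X] {η}

theorem isOpenMap_source (hdom : ∀ g, IsOpen (η.domAt g)) : IsOpenMap η.source := by
  rintro _ ⟨V, hV, rfl⟩
  have image_eq : η.source '' (Subtype.val ⁻¹' V) = ⋃ g, η.domAt g⁻¹ ∩ Prod.mk g ⁻¹' V := by
    ext x
    simp [source, domAt, and_comm]
  rw [image_eq]
  exact isOpen_iUnion fun g => (hdom g⁻¹).inter (hV.preimage (Continuous.prodMk_right g))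

theorem isProperMap_source [CompactSpace G] (hclosed : IsClosed η.dom) : IsProperMap η.source :=
  isProperMap_snd_of_compactSpace.comp hclosed.isClosedEmbedding_subtypeVal.isProperMap

theorem isOpenQuotientMap_mk (hsource : IsOpenMap η.source) (htarget : Continuous η.target) :
    IsOpenQuotientMap (Quotient.mk η.orbitSetoid) where
  surjective := Quotient.mk_surjective
  continuous := continuous_quotient_mk'
  isOpenMap U hU := by
    rw [← (isQuotientMap_quotient_mk' (s := η.orbitSetoid)).isOpen_preimage]
    exact η.mk_preimage_image_mk U ▸ hsource _ (hU.preimage htarget)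

theorem isProperMap_mk (hsource : IsProperMap η.source) (htarget : Continuous η.target) :
    IsProperMap (Quotient.mk η.orbitSetoid) := by
  refine isProperMap_iff_isClosedMap_and_compact_fibers.2
    ⟨continuous_quotient_mk', fun C hC => ?_, Quotient.mk_surjective.forall.2 fun x => ?_⟩
  · rw [← (isQuotientMap_quotient_mk' (s := η.orbitSetoid)).isClosed_preimage]
    exact η.mk_preimage_image_mk C ▸ hsource.isClosedMap _ (hC.preimage htarget)
  · rw [mk_preimage_singleton_mk]
    exact (hsource.isCompact_preimage isCompact_singleton).image htarget

/-- The domain of `η.prodAction` is `G × (G * X)`, in such a way that its source map becomes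
`id × η.source`. -/
def prodActionDomHomeomorph : η.prodAction.dom ≃ₜ G × η.dom where
  toFun p := (p.1.2.1, ⟨(p.1.1, p.1.2.2), p.2⟩)
  invFun q := ⟨(q.2.1.1, q.1, q.2.1.2), q.2.2⟩

theorem isOpenMap_source_prodAction (hsource : IsOpenMap η.source) :
    IsOpenMap η.prodAction.source :=
  (IsOpenMap.id.prodMap hsource).comp prodActionDomHomeomorph.isOpenMap

theorem isProperMap_source_prodAction (hsource : IsProperMap η.source) :
    IsProperMap η.prodAction.source :=
  (isProperMap_id.prodMap hsource).comp prodActionDomHomeomorph.isProperMap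

theorem continuous_target_prodAction [ContinuousMul G] [ContinuousInv G]
    (htarget : Continuous η.target) : Continuous η.prodAction.target := by
  have hfst : Continuous fun p : η.prodAction.dom => p.1.2.1 * p.1.1⁻¹ := by fun_prop
  exact hfst.prodMk (htarget.comp (continuous_snd.comp prodActionDomHomeomorph.continuous))

theorem isOpenQuotientMap_mk_envelopingSetoid [ContinuousMul G] [ContinuousInv G]
    (hsource : IsOpenMap η.source) (htarget : Continuous η.target) :
    IsOpenQuotientMap (Quotient.mk η.envelopingSetoid) := by
  rw [← orbitSetoid_prodAction]
  exact isOpenQuotientMap_mk (isOpenMap_source_prodAction hsource)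
    (continuous_target_prodAction htarget)

theorem isProperMap_mk_envelopingSetoid [ContinuousMul G] [ContinuousInv G]
    (hsource : IsProperMap η.source) (htarget : Continuous η.target) :
    IsProperMap (Quotient.mk η.envelopingSetoid) := by
  rw [← orbitSetoid_prodAction]
  exact isProperMap_mk (isProperMap_source_prodAction hsource)
    (continuous_target_prodAction htarget)

end PartialAction

open PartialAction

theorem theorem3p2_general {G : Type*} {X : Type*} [Group G] [TopologicalSpace G]
    [IsTopologicalGroup G] [TopologicalSpace X] (η : PartialAction G X)
    (hopen : IsOpenMap η.source) (hproper : IsProperMap η.source) (hcont : Continuous η.target) :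
    ((T2Space X → T2Space η.OrbitSpace) ∧
      (RegularSpace X → RegularSpace η.OrbitSpace) ∧
      (T3Space X → T3Space η.OrbitSpace) ∧
      (MetrizableSpace X → MetrizableSpace η.OrbitSpace) ∧
      (SecondCountableTopology X → SecondCountableTopology η.OrbitSpace)) ∧
    ((T2Space (G × X) → T2Space η.EnvelopingSpace) ∧
      (RegularSpace (G × X) → RegularSpace η.EnvelopingSpace) ∧
      (T3Space (G × X) → T3Space η.EnvelopingSpace) ∧
      (MetrizableSpace (G × X) → MetrizableSpace η.EnvelopingSpace) ∧
      (SecondCountableTopology (G × X) → SecondCountableTopology η.EnvelopingSpace)) := by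
  have orbit := isEmbedding_compactFiber (isOpenQuotientMap_mk hopen hcont)
    (isProperMap_mk hproper hcont)
  have enveloping := isEmbedding_compactFiber (isOpenQuotientMap_mk_envelopingSetoid hopen hcont)
    (isProperMap_mk_envelopingSetoid hproper hcont)
  exact ⟨⟨fun _ => orbit.t2Space, fun _ => orbit.isInducing.regularSpace, fun _ => orbit.t3Space,
      fun _ => orbit.metrizableSpace, fun _ => orbit.secondCountableTopology⟩,
    ⟨fun _ => enveloping.t2Space, fun _ => enveloping.isInducing.regularSpace,
      fun _ => enveloping.t3Space, fun _ => enveloping.metrizableSpace,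
      fun _ => enveloping.secondCountableTopology⟩⟩

theorem theorem3p2 {G : Type*} {X : Type*} [Group G] [TopologicalSpace G] [IsTopologicalGroup G]
    [CompactSpace G] [TopologicalSpace X] (η : PartialAction G X)
    (hη : η.IsContinuousTopological) (hclosed : IsClosed η.dom) :
    ((T2Space X → T2Space η.OrbitSpace) ∧
      (RegularSpace X → RegularSpace η.OrbitSpace) ∧
      (T3Space X → T3Space η.OrbitSpace) ∧
      (TopologicalSpace.MetrizableSpace X → TopologicalSpace.MetrizableSpace η.OrbitSpace) ∧
      (SecondCountableTopology X → SecondCountableTopology η.OrbitSpace)) ∧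
    ((T2Space (G × X) → T2Space η.EnvelopingSpace) ∧
      (RegularSpace (G × X) → RegularSpace η.EnvelopingSpace) ∧
      (T3Space (G × X) → T3Space η.EnvelopingSpace) ∧
      (TopologicalSpace.MetrizableSpace (G × X) →
        TopologicalSpace.MetrizableSpace η.EnvelopingSpace) ∧
      (SecondCountableTopology (G × X) → SecondCountableTopology η.EnvelopingSpace)) := by
  exact theorem3p2_general η (isOpenMap_source hη.isOpen_domAt) (isProperMap_source hclosed)
    hη.continuous_act
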